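/- Let $\epsilon>0$ and $d\in\mathbb R$. For a finite non-empty metric space $X=(X,\partial)$ and $r\ge 0$, let $\mathcal R(X)_r$ be the Rips complex, whose simplices are the non-empty subsets of $X$ of diameter at most $2r$; let $E$ be the set of two-element subsets (edges) of $X$, let $b_e=\min\{r\ge 0\mid e\in\mathcal R(X)_r\}$ for $e\in E$, and let $R=\{b_e\mid e\in E\}$. Define $Q=\{q_1,\dots,q_n\}$ as follows: $Q=\emptyset$ if $|X|=1$. Otherwise $q_1=\min R$; given $q_i$, let $R^i=\{r\in R\mid r>q_i\}$; if $R^i\neq\emptyset$, put $q_{i+1}=\max\{\min R^i,\,q_i(1+\epsilon)\}$, and if $R^i=\emptyset$, stop with $n=i$. Put $q_0=0$. For $x\in X$ and $r>0$, let $S(x,r)$ be a set of simplices of $\mathcal R(X)_{r(1+\epsilon)}$, each containing $x$, such that (1) $|S(x,r)|\le K$ for some $K$ independent of $x$ and $r$; (2) every $\sigma\in\mathcal R(X)_r$ with $x\in\sigma$ is contained in some $\tau\in S(x,r)$; (3) for $r'\ge r(1+\epsilon)$, every $\sigma\in S(x,r)$ is contained in some $\tau\in S(x,r')$. For each $e\in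 E$ choose a vertex $x_e\in e$. For $1\le i\le n$ let $E_i=\{e\in E\mid q_{i-1}<b_e\le q_i\}$ and $S(q_i)=\bigcup_{e\in E_i}S(x_e,q_i)$. For $r\ge 0$ let $\mathcal A(X)_r$ be the simplicial complex consisting of all vertices of $X$ together with, for every $i$ with $q_i\le r$, all simplices of $S(q_i)$ and their faces; if $|X|=1$, let $\mathcal A(X)_r=\mathcal R(X)_r$. The doubling dimension of $X$ is the minimum $\lambda\in\mathbb R$ such that every closed ball in $X$ can be covered by at most $2^\lambda$ closed balls of half the radius. Proposition. There is a constant $C$, depending only on $\epsilon$ and $d$, such that for every finite non-empty metric space $X$ of doubling dimension at most $d$: the set $Q$ is finite, any two elements $p<q$ of $Q$ satisfy $p(1+\epsilon)\le q$, and $$|Q|\le C\,|X|.$$ Moreover, for all choices of the sets $S(x,r)$ and of the vertices $x_e$ as above, the number of distinct complexes among $\mathcal A(X)_r$, $r\in[0,\infty)$, is at most $C\,|X|$. -/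

import Mathlib

open scoped NNReal

namespace SparseRips

noncomputable section

/-- Every closed ball of `X` can be covered by at most `2 ^ l` closed balls of half the radius. -/
def CoveredByHalfBalls (X : Type*) [MetricSpace X] (l : ℝ) : Prop :=
  ∀ (x : X) (r : ℝ), 0 ≤ r → ∃ t : Finset X, (t.card : ℝ) ≤ (2 : ℝ) ^ l ∧
    Metric.closedBall x r ⊆ ⋃ y ∈ t, Metric.closedBall y (r / 2)

/-- `d` is the doubling dimension of `X`: the minimum `l` such that every ball can be covered by
at most `2 ^ l` balls of half the radius. -/
def HasDoublingDim (X : Type*) [MetricSpace X] (d : ℝ) : Prop :=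
  IsLeast {l : ℝ | CoveredByHalfBalls X l} d

/-- The Rips complex at scale `r`: the non-empty finite subsets of diameter at most `2 r`. -/
def rips (X : Type*) [MetricSpace X] (r : ℝ≥0) : AbstractSimplicialComplex X where
  faces := {s | s.Nonempty ∧ Metric.diam (s : Set X) ≤ 2 * (r : ℝ)}
  isRelLowerSet_faces := by
    rintro s ⟨hs, hd⟩
    refine ⟨hs, fun t hts ht => ⟨ht, le_trans ?_ hd⟩⟩
    exact Metric.diam_mono (Finset.coe_subset.mpr hts) s.finite_toSet.isBounded
  singleton_mem := by
    intro v
    refine ⟨Finset.singleton_nonempty v, ?_⟩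
    simp

/-- The birth index of a simplex: the least `r` at which it lies in the Rips complex. -/
def birth {X : Type*} [MetricSpace X] (s : Finset X) : ℝ≥0 :=
  sInf {r : ℝ≥0 | s ∈ rips X r}

/-- The edges (`1`-simplices) of the union of all the Rips complexes. -/
def edges (X : Type*) [MetricSpace X] : Set (Finset X) :=
  {e | e.card = 2 ∧ ∃ r : ℝ≥0, e ∈ rips X r}

/-- The set `R` of birth indices of edges. -/
def edgeBirths (X : Type*) [MetricSpace X] : Set ℝ≥0 :=
  birth '' edges X

/-- `IsScale X ε i q` says that `q` is the `i`-th scale `q_i` in the greedy construction: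
`q_0 = 0`, `q_1 = min R`, and `q_{i+1} = max {min {r ∈ R | q_i < r}, q_i (1 + ε)}` for `i ≥ 1`
if the set `{r ∈ R | q_i < r}` is non-empty; if it is empty, there is no `(i+1)`-st scale. -/
inductive IsScale (X : Type*) [MetricSpace X] (ε : ℝ≥0) : ℕ → ℝ≥0 → Prop
  | zero : IsScale X ε 0 0
  | one {q : ℝ≥0} (h : IsLeast (edgeBirths X) q) : IsScale X ε 1 q
  | step {i : ℕ} {q m : ℝ≥0} (hi : 1 ≤ i) (hq : IsScale X ε i q)
      (hm : IsLeast {r | r ∈ edgeBirths X ∧ q < r} m) :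
      IsScale X ε (i + 1) (max m (q * (1 + ε)))

/-- The set `Q = {q_1, …, q_n}` of scales (`q_0 = 0` is not included). -/
def scales (X : Type*) [MetricSpace X] (ε : ℝ≥0) : Set ℝ≥0 :=
  {q | ∃ i : ℕ, 1 ≤ i ∧ IsScale X ε i q}

/-- `S x r` (for `x : X` and `r > 0`) is a set of at most `K` simplices of the Rips complex at
`r (1 + ε)`, each containing `x`, such that every simplex of the Rips complex at `r` containing `x`
is contained in a member of `S x r`, and every member of `S x r` is contained in a member of
`S x r'` whenever `r' ≥ r (1 + ε)`. -/
structure IsSimplexFamily {X : Type*} [MetricSpace X] (ε : ℝ≥0) (K : ℕ)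
    (S : X → ℝ≥0 → Set (Finset X)) : Prop where
  mem_rips : ∀ (x : X) (r : ℝ≥0), 0 < r → ∀ s ∈ S x r, s ∈ rips X (r * (1 + ε)) ∧ x ∈ s
  finite : ∀ (x : X) (r : ℝ≥0), 0 < r → (S x r).Finite
  card_le : ∀ (x : X) (r : ℝ≥0), 0 < r → (S x r).ncard ≤ K
  covers : ∀ (x : X) (r : ℝ≥0), 0 < r → ∀ s ∈ rips X r, x ∈ s → ∃ t ∈ S x r, s ⊆ t
  persists : ∀ (x : X) (r r' : ℝ≥0), 0 < r → r * (1 + ε) ≤ r' →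
    ∀ s ∈ S x r, ∃ t ∈ S x r', s ⊆ t

/-- A choice of a vertex `c e` of every edge `e`. -/
def IsVertexChoice {X : Type*} [MetricSpace X] (c : Finset X → X) : Prop :=
  ∀ e ∈ edges X, c e ∈ e

/-- The complex consisting of the simplices of `Z` and all their (non-empty) faces. -/
def faceClosure {X : Type*} (Z : Set (Finset X)) : PreAbstractSimplicialComplex X where
  faces := {t | t.Nonempty ∧ ∃ s ∈ Z, t ⊆ s}
  isRelLowerSet_faces := by
    rintro t ⟨ht, s, hs, hts⟩
    exact ⟨ht, fun u hut hu => ⟨hu, s, hs, subset_trans hut hts⟩⟩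

/-- The set `E_{i+1}` of edges with birth index in `(q_i, q_{i+1}]`. -/
def edgesAt (X : Type*) [MetricSpace X] (ε : ℝ≥0) (i : ℕ) : Set (Finset X) :=
  {e | e ∈ edges X ∧ ∃ p q : ℝ≥0, IsScale X ε i p ∧ IsScale X ε (i + 1) q ∧
    birth e ∈ Set.Ioc p q}

/-- The set `S(q_{i+1})`, the union of the sets `S (c e) q_{i+1}` over all `e ∈ E_{i+1}`;
here `q` is `q_{i+1}`. -/
def selected {X : Type*} [MetricSpace X] (ε : ℝ≥0) (S : X → ℝ≥0 → Set (Finset X))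
    (c : Finset X → X) (i : ℕ) (q : ℝ≥0) : Set (Finset X) :=
  ⋃ e ∈ edgesAt X ε i, S (c e) q

/-- The filtration `A(X)` determined by the choices `S` and `c`: it is the Rips filtration if `X`
has at most one point; otherwise the complex at `r` consists of all the vertices of `X` and of
the closures of the sets `S(q_i)` with `1 ≤ i` and `q_i ≤ r`. -/
def approx {X : Type*} [MetricSpace X] (ε : ℝ≥0) (S : X → ℝ≥0 → Set (Finset X))
    (c : Finset X → X) (r : ℝ≥0) : AbstractSimplicialComplex X :=
  if Nat.card X ≤ 1 then rips X r
  else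
    (⨆ (i : ℕ) (q : ℝ≥0) (_ : IsScale X ε (i + 1) q) (_ : q ≤ r),
      faceClosure (selected ε S c i q)).addSingletons

end

end SparseRips

/-!
The number of scales is linear in the number of points of an arbitrary finite metric space.

The key fact is `card_le_of_lacunary_distances`: in a finite metric space, a set of positive
distances in which any two differ at least by a factor `6` has at most `|X|` elements. To see this,
run through the distances `a` in decreasing order and build an increasing chain of subsets of `X`,
the one belonging to `a` being a maximal set whose points are pairwise more than `a / 4` apart.
If `dist x y = a`, the members of that net closest to `x` and `y` are distinct and at distance at
most `3 a / 2`, while the points of the previous net are pairwise more than `6 a / 4` apart. So the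
nets grow strictly.

Each scale `q_i` comes with an edge whose birth index lies in `(q_{i-1}, q_i]`
(`IsScale.exists_dist`), and consecutive scales differ by a factor of at least `1 + ε`
(`IsScale.exists_of_le`). If `(1 + ε) ^ m ≥ 6`, the edges belonging to every `(m + 1)`-st scale have
lacunary lengths, hence there are at most `(m + 1) |X|` scales (`IsScale.index_le`). Finally, the
complex `A(X)_r` depends only on how many scales are at most `r`, which takes at most
`(m + 1) |X| + 1` values.
-/

namespace SparseRips

/-! ### Lacunary distances in a finite metric space -/

section Lacunary

variable {X : Type*} [MetricSpace X] [Finite X]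

/-- Every `δ`-separated set extends to a `δ`-separated set which is `δ`-dense. -/
lemma exists_separated_net (N : Finset X) {δ : ℝ} (hδ : 0 ≤ δ)
    (hN : ∀ x ∈ N, ∀ y ∈ N, x ≠ y → δ < dist x y) :
    ∃ N' : Finset X, N ⊆ N' ∧ (∀ x ∈ N', ∀ y ∈ N', x ≠ y → δ < dist x y) ∧
      ∀ x, ∃ y ∈ N', dist x y ≤ δ := by
  classical
  obtain ⟨N', hNN', hmax⟩ :=
    (Set.toFinite {A : Finset X | ∀ x ∈ A, ∀ y ∈ A, x ≠ y → δ < dist x y}).exists_le_maximal hN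
  refine ⟨N', hNN', hmax.prop, fun x => ?_⟩
  by_contra! hx
  have hsep : ∀ y ∈ insert x N', ∀ z ∈ insert x N', y ≠ z → δ < dist y z := by
    intro y hy z hz hyz
    rw [Finset.mem_insert] at hy hz
    rcases hy with rfl | hy <;> rcases hz with rfl | hz
    · exact absurd rfl hyz
    · exact hx z hz
    · rw [dist_comm]
      exact hx y hy
    · exact hmax.prop y hy z hz hyz
  have hmem : x ∈ N' := hmax.le_of_ge hsep (Finset.subset_insert x N') (Finset.mem_insert_self x N')
  have := hx x hmem
  rw [dist_self] at this
  linarith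

/-- The induction inserts a new smallest distance, which forces a new point. -/
lemma exists_separated_of_lacunary (D : Finset ℝ) (hne : D.Nonempty) :
    (∀ a ∈ D, 0 < a ∧ ∃ x y : X, dist x y = a) → (∀ a ∈ D, ∀ b ∈ D, a < b → 6 * a ≤ b) →
      ∃ N : Finset X, D.card ≤ N.card ∧
        ∃ a ∈ D, ∀ x ∈ N, ∀ y ∈ N, x ≠ y → a / 4 < dist x y := by
  classical
  induction D using Finset.induction_on_min with
  | empty => exact absurd hne Finset.not_nonempty_empty
  | insert a D hlt ih =>
    intro hD hlac
    obtain ⟨ha, x, y, hxy⟩ := hD a (Finset.mem_insert_self a D)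
    rw [Finset.card_insert_of_notMem fun h => (hlt a h).false]
    rcases D.eq_empty_or_nonempty with rfl | hDne
    · exact ⟨{x}, by simp, a, by simp, by simp⟩
    obtain ⟨N, hcard, b, hb, hsep⟩ := ih hDne (fun b hb => hD b (Finset.mem_insert_of_mem hb))
      fun b hb b' hb' => hlac b (Finset.mem_insert_of_mem hb) b' (Finset.mem_insert_of_mem hb')
    have hab : 6 * a ≤ b :=
      hlac a (Finset.mem_insert_self a D) b (Finset.mem_insert_of_mem hb) (hlt b hb)
    obtain ⟨N', hNN', hsep', hdense⟩ := exists_separated_net N (δ := a / 4) (by linarith)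
      fun u hu v hv huv => by linarith [hsep u hu v hv huv]
    obtain ⟨u, hu, hxu⟩ := hdense x
    obtain ⟨v, hv, hyv⟩ := hdense y
    have huv : u ≠ v := by
      rintro rfl
      linarith [dist_triangle_right x y u]
    have huv' : dist u v ≤ 3 * a / 2 := by
      linarith [dist_triangle4 u x y v, dist_comm u x]
    refine ⟨N', ?_, a, Finset.mem_insert_self a D, hsep'⟩
    refine Nat.succ_le_of_lt (hcard.trans_lt (Finset.card_lt_card (hNN'.ssubset_of_ne ?_)))
    rintro rfl
    linarith [hsep u hu v hv huv]

/-- A set of positive distances, any two of which differ at least by a factor `6`, has at most as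
many elements as the space. -/
lemma card_le_of_lacunary_distances (D : Finset ℝ)
    (hD : ∀ a ∈ D, 0 < a ∧ ∃ x y : X, dist x y = a)
    (hlac : ∀ a ∈ D, ∀ b ∈ D, a < b → 6 * a ≤ b) : D.card ≤ Nat.card X := by
  rcases D.eq_empty_or_nonempty with rfl | hne
  · simp
  · obtain ⟨N, hN, -⟩ := exists_separated_of_lacunary D hne hD hlac
    exact hN.trans ((Set.ncard_coe_finset N).symm.le.trans (Set.ncard_le_card _))

end Lacunary

/-! ### Scales -/

section Scales

variable {X : Type*} [MetricSpace X] {ε : ℝ≥0}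

lemma exists_birth_of_mem_edges {e : Finset X} (he : e ∈ edges X) :
    ∃ x y : X, 0 < dist x y ∧ ((birth e : ℝ≥0) : ℝ) = dist x y / 2 := by
  classical
  obtain ⟨x, y, hxy, rfl⟩ := Finset.card_eq_two.mp he.1
  refine ⟨x, y, dist_pos.mpr hxy, ?_⟩
  have hset : {r : ℝ≥0 | ({x, y} : Finset X) ∈ rips X r} = Set.Ici (nndist x y / 2) := by
    ext r
    have : ({x, y} : Finset X) ∈ rips X r ↔ dist x y ≤ 2 * (r : ℝ) := by
      change (_ ∧ _) ↔ _
      simp [Metric.diam_pair]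
    rw [Set.mem_ofPred_eq, this, Set.mem_Ici, ← NNReal.coe_le_coe, NNReal.coe_div, coe_nndist,
      NNReal.coe_ofNat, div_le_iff₀' two_pos]
  rw [birth, hset, csInf_Ici]
  simp

lemma IsScale.eq {i : ℕ} {p q : ℝ≥0} (hp : IsScale X ε i p) (hq : IsScale X ε i q) : p = q := by
  induction hp generalizing q with
  | zero =>
    cases hq
    rfl
  | one h =>
    cases hq with
    | one h' => exact h.unique h'
    | step hi => omega
  | step hi hp hm ih =>
    cases hq with
    | one => omega
    | step _ hq hm' =>
      obtain rfl := ih hq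
      rw [hm.unique hm']

/-- Earlier scales exist, and `i` steps multiply a scale by `(1 + ε) ^ i` at least. -/
lemma IsScale.exists_of_le {i : ℕ} (hi : 1 ≤ i) {j : ℕ} {q : ℝ≥0} (hq : IsScale X ε j q)
    (hij : i ≤ j) : ∃ p, IsScale X ε i p ∧ p * (1 + ε) ^ (j - i) ≤ q := by
  induction hq with
  | zero => omega
  | @one q h =>
    obtain rfl : i = 1 := by omega
    exact ⟨q, .one h, by simp⟩
  | @step j q m hj hq hm ih =>
    rcases hij.eq_or_lt with rfl | hlt
    · exact ⟨_, .step hj hq hm, by simp⟩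
    · obtain ⟨p, hp, hpq⟩ := ih (by omega)
      refine ⟨p, hp, le_max_of_le_right ?_⟩
      rw [show j + 1 - i = j - i + 1 by omega, pow_succ, ← mul_assoc]
      gcongr

/-- Every scale `q_{i+1}` comes with an edge whose birth index lies in `(q_i, q_{i+1}]`. -/
lemma IsScale.exists_dist {i : ℕ} {q : ℝ≥0} (hq : IsScale X ε (i + 1) q) :
    ∃ x y : X, 0 < dist x y ∧ dist x y / 2 ≤ q ∧ ∀ p, IsScale X ε i p → (p : ℝ) < dist x y / 2 := by
  cases hq with
  | one h =>
    obtain ⟨e, he, rfl⟩ := h.1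
    obtain ⟨x, y, hpos, hb⟩ := exists_birth_of_mem_edges he
    refine ⟨x, y, hpos, hb.ge, fun p hp => ?_⟩
    obtain rfl := hp.eq .zero
    simpa using hpos
  | step hi hq' hm =>
    obtain ⟨⟨e, he, rfl⟩, hlt⟩ := hm.1
    obtain ⟨x, y, hpos, hb⟩ := exists_birth_of_mem_edges he
    refine ⟨x, y, hpos, ?_, fun p hp => ?_⟩
    · rw [← hb]
      exact_mod_cast le_max_left _ _
    · obtain rfl := hp.eq hq'
      rw [← hb]
      exact_mod_cast hlt

/-- The edges belonging to the scales with indices `1, (m + 1) + 1, 2 (m + 1) + 1, …` have lacunary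
lengths, so there are at most `|X|` such indices. -/
lemma IsScale.index_le [Finite X] {m : ℕ} (hm : 6 ≤ (1 + ε) ^ m) {i : ℕ} {q : ℝ≥0}
    (hq : IsScale X ε i q) : i ≤ (m + 1) * Nat.card X := by
  classical
  by_contra! hlt
  have key : ∀ k ≤ Nat.card X, ∃ l : ℝ, ∃ q : ℝ≥0, IsScale X ε ((m + 1) * k + 1) q ∧
      (0 < l ∧ ∃ x y : X, dist x y = l) ∧ l / 2 ≤ q ∧
      ∀ p, IsScale X ε ((m + 1) * k) p → (p : ℝ) < l / 2 := by
    intro k hk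
    have hki : (m + 1) * k + 1 ≤ i := (Nat.mul_le_mul_left (m + 1) hk).trans_lt hlt
    obtain ⟨q', hq', -⟩ := hq.exists_of_le (Nat.le_add_left 1 _) hki
    obtain ⟨x, y, hpos, hle, hgt⟩ := hq'.exists_dist
    exact ⟨dist x y, q', hq', ⟨hpos, x, y, rfl⟩, hle, hgt⟩
  choose! l s hs hl hls hgt using key
  have hlac : ∀ j k, j < k → k ≤ Nat.card X → 6 * l j ≤ l k := by
    intro j k hjk hk
    have h1 : (m + 1) * j + (m + 1) ≤ (m + 1) * k := Nat.mul_le_mul_left (m + 1) hjk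
    obtain ⟨p, hp, -⟩ := (hs k hk).exists_of_le (i := (m + 1) * k) (by omega) (by omega)
    obtain ⟨p', hp', hle⟩ := hp.exists_of_le (i := (m + 1) * j + 1) (by omega) (by omega)
    obtain rfl := hp'.eq (hs j (by omega))
    have h2 : s j * 6 ≤ p := by
      refine le_trans ?_ hle
      gcongr
      exact hm.trans (pow_le_pow_right₀ (by simp) (by omega))
    have h3 : (s j : ℝ) * 6 ≤ p := by exact_mod_cast h2
    linarith [hls j (by omega), hgt k hk p hp]
  have hmono : ∀ j k, j < k → k ≤ Nat.card X → l j < l k := fun j k hjk hk => by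
    linarith [hlac j k hjk hk, (hl j (by omega)).1]
  have hinj : Set.InjOn l (Finset.range (Nat.card X + 1)) := by
    intro j hj k hk hjk
    simp only [Finset.coe_range, Set.mem_Iio] at hj hk
    rcases lt_trichotomy j k with h | h | h
    · exact absurd hjk (hmono j k h (by omega)).ne
    · exact h
    · exact absurd hjk (hmono k j h (by omega)).ne'
  have hcard := card_le_of_lacunary_distances (X := X) ((Finset.range (Nat.card X + 1)).image l)
    (fun a ha => by
      obtain ⟨k, hk, rfl⟩ := Finset.mem_image.mp ha
      exact hl k (by simpa [Nat.lt_succ_iff] using hk))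
    (fun a ha b hb hab => by
      obtain ⟨j, hj, rfl⟩ := Finset.mem_image.mp ha
      obtain ⟨k, hk, rfl⟩ := Finset.mem_image.mp hb
      rw [Finset.mem_range] at hj hk
      refine hlac j k ?_ (by omega)
      by_contra! hkj
      rcases hkj.eq_or_lt with rfl | hkj
      · exact hab.false
      · exact hab.asymm (hmono k j hkj (by omega)))
  rw [Finset.card_image_of_injOn hinj, Finset.card_range] at hcard
  omega

lemma mul_le_of_lt_of_mem_scales {p q : ℝ≥0} (hp : p ∈ scales X ε) (hq : q ∈ scales X ε)
    (hpq : p < q) : p * (1 + ε) ≤ q := by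
  obtain ⟨i, hi, hp⟩ := hp
  obtain ⟨j, hj, hq⟩ := hq
  have hone : (1 : ℝ≥0) ≤ 1 + ε := by simp
  rcases lt_or_ge i j with hij | hij
  · obtain ⟨p', hp', hle⟩ := hq.exists_of_le hi hij.le
    obtain rfl := hp'.eq hp
    refine le_trans ?_ hle
    gcongr
    exact le_self_pow₀ hone (by omega)
  · obtain ⟨q', hq', hle⟩ := hp.exists_of_le hj hij
    obtain rfl := hq'.eq hq
    exact absurd ((le_mul_of_one_le_right zero_le (one_le_pow₀ hone)).trans hle) hpq.not_ge

lemma scales_finite_and_ncard_le [Finite X] {m : ℕ} (hm : 6 ≤ (1 + ε) ^ m) :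
    (scales X ε).Finite ∧ (scales X ε).ncard ≤ (m + 1) * Nat.card X := by
  classical
  choose! f hf using fun (q : ℝ≥0) (hq : q ∈ scales X ε) => hq
  have hmaps : Set.MapsTo f (scales X ε) (Set.Icc 1 ((m + 1) * Nat.card X)) :=
    fun q hq => ⟨(hf q hq).1, (hf q hq).2.index_le hm⟩
  have hinj : Set.InjOn f (scales X ε) := fun p hp q hq hpq =>
    (hf p hp).2.eq (hpq ▸ (hf q hq).2)
  refine ⟨.of_injOn hmaps hinj (Set.finite_Icc _ _), ?_⟩
  refine (Set.ncard_le_ncard_of_injOn f hmaps hinj (Set.finite_Icc _ _)).trans ?_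
  rw [← Finset.coe_Icc, Set.ncard_coe_finset]
  simp

end Scales

/-! ### The approximating complexes -/

section Approx

variable {X : Type*} [MetricSpace X] {ε : ℝ≥0}

lemma rips_eq_of_subsingleton [Subsingleton X] (r s : ℝ≥0) : rips X r = rips X s := by
  have key : ∀ (t : ℝ≥0) (u : Finset X), u ∈ rips X t ↔ u.Nonempty := by
    intro t u
    change (_ ∧ _) ↔ _
    simp [Metric.diam_subsingleton (Set.subsingleton_of_subsingleton (s := (u : Set X)))]
  ext u
  exact (key r u).trans (key s u).symm

/-- The complex built from the first `k` scales. -/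
noncomputable def approxStage (ε : ℝ≥0) (S : X → ℝ≥0 → Set (Finset X)) (c : Finset X → X)
    (k : ℕ) : AbstractSimplicialComplex X :=
  (⨆ (i : ℕ) (q : ℝ≥0) (_ : IsScale X ε (i + 1) q) (_ : i < k),
    faceClosure (selected ε S c i q)).addSingletons

lemma exists_approx_eq_approxStage [Finite X] {m : ℕ} (hm : 6 ≤ (1 + ε) ^ m)
    (hX : 1 < Nat.card X) (S : X → ℝ≥0 → Set (Finset X)) (c : Finset X → X) (r : ℝ≥0) :
    ∃ k ≤ (m + 1) * Nat.card X, approx ε S c r = approxStage ε S c k := by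
  classical
  have hex : ∃ k, ¬ ∃ q, IsScale X ε (k + 1) q ∧ q ≤ r := by
    refine ⟨(m + 1) * Nat.card X, ?_⟩
    rintro ⟨q, hq, -⟩
    exact absurd (hq.index_le hm) (by omega)
  refine ⟨Nat.find hex, Nat.find_min' hex ?_, ?_⟩
  · rintro ⟨q, hq, -⟩
    exact absurd (hq.index_le hm) (by omega)
  have key : ∀ i q, IsScale X ε (i + 1) q → (q ≤ r ↔ i < Nat.find hex) := by
    intro i q hq
    constructor
    · intro hqr
      by_contra hle
      obtain ⟨p, hp, hpq⟩ := hq.exists_of_le (Nat.le_add_left 1 _)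
        (Nat.add_le_add_right (not_lt.mp hle) 1)
      exact Nat.find_spec hex ⟨p, hp,
        (le_mul_of_one_le_right zero_le (one_le_pow₀ (by simp))).trans (hpq.trans hqr)⟩
    · intro hi
      obtain ⟨p, hp, hpr⟩ := not_not.mp (Nat.find_min hex hi)
      rwa [hq.eq hp]
  rw [approx, if_neg (by omega), approxStage]
  congr 1
  refine iSup_congr fun i => iSup_congr fun q => iSup_congr fun hq => ?_
  exact iSup_congr_Prop (key i q hq) fun _ => rfl

lemma range_approx_finite_and_ncard_le [Finite X] [Nonempty X] {m : ℕ} (hm : 6 ≤ (1 + ε) ^ m)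
    (S : X → ℝ≥0 → Set (Finset X)) (c : Finset X → X) :
    (Set.range (approx ε S c)).Finite ∧
      (Set.range (approx ε S c)).ncard ≤ (m + 2) * Nat.card X := by
  have hpos : 0 < Nat.card X := Nat.card_pos
  rcases lt_or_ge 1 (Nat.card X) with hX | hX
  · have hsub : Set.range (approx ε S c) ⊆
        approxStage ε S c '' Set.Iic ((m + 1) * Nat.card X) := by
      rintro _ ⟨r, rfl⟩
      obtain ⟨k, hk, h⟩ := exists_approx_eq_approxStage hm hX S c r
      exact ⟨k, hk, h.symm⟩
    have hfin := (Set.finite_Iic ((m + 1) * Nat.card X)).image (approxStage ε S c)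
    refine ⟨hfin.subset hsub, (Set.ncard_le_ncard hsub hfin).trans
      ((Set.ncard_image_le (Set.finite_Iic _)).trans ?_)⟩
    rw [← Finset.coe_Iic, Set.ncard_coe_finset, Nat.card_Iic]
    linarith
  · have : Subsingleton X := Finite.card_le_one_iff_subsingleton.mp hX
    have hsub : Set.range (approx ε S c) ⊆ {rips X 0} := by
      rintro _ ⟨r, rfl⟩
      rw [approx, if_pos hX]
      exact rips_eq_of_subsingleton r 0
    refine ⟨(Set.finite_singleton _).subset hsub, (Set.ncard_le_ncard hsub).trans ?_⟩
    rw [Set.ncard_singleton]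
    exact Nat.mul_pos (by omega) hpos

end Approx

end SparseRips

theorem proposition3p3 (ε : ℝ≥0) (hε : 0 < ε) (d : ℝ) :
    ∃ C : ℝ, ∀ (X : Type*) [MetricSpace X] [Finite X] [Nonempty X] (d' : ℝ),
      SparseRips.HasDoublingDim X d' → d' ≤ d →
        ((SparseRips.scales X ε).Finite ∧
          (∀ p ∈ SparseRips.scales X ε, ∀ q ∈ SparseRips.scales X ε,
            p < q → p * (1 + ε) ≤ q) ∧
          ((SparseRips.scales X ε).ncard : ℝ) ≤ C * (Nat.card X : ℝ)) ∧
        ∀ (K : ℕ) (S : X → ℝ≥0 → Set (Finset X)) (c : Finset X → X),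
          SparseRips.IsSimplexFamily ε K S → SparseRips.IsVertexChoice c →
            (Set.range (SparseRips.approx ε S c)).Finite ∧
            ((Set.range (SparseRips.approx ε S c)).ncard : ℝ) ≤ C * (Nat.card X : ℝ) := by
  
  obtain ⟨m, hm⟩ := pow_unbounded_of_one_lt 6 (lt_add_of_pos_right 1 hε)
  refine ⟨(m + 2 : ℕ), fun X _ _ _ _ _ _ => ?_⟩
  obtain ⟨hfin, hcard⟩ := SparseRips.scales_finite_and_ncard_le (X := X) hm.le
  refine ⟨⟨hfin, fun p hp q hq => SparseRips.mul_le_of_lt_of_mem_scales hp hq, ?_⟩,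
    fun _ S c _ _ => ?_⟩
  · exact_mod_cast hcard.trans (Nat.mul_le_mul_right _ (by omega))
  · obtain ⟨hfin', hcard'⟩ := SparseRips.range_approx_finite_and_ncard_le hm.le S c
    exact ⟨hfin', by exact_mod_cast hcard'⟩
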